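/- Let $(M,g)$ be a smooth Riemannian manifold of dimension $n>3$ with Levi-Civita connection $\nabla$ and Ricci tensor field $\mathrm{Ric}$. Let $V$ be a smooth vector field on $M$, let $\lambda$ be a smooth real function on $M$, and let $a\neq 0$ be a real constant. Suppose that (i) $(V,\lambda)$ is an almost Ricci soliton on $(M,g)$, that is, $\tfrac12\mathcal{L}_V g+\mathrm{Ric}=\lambda g$, where $\mathcal{L}_V g$ is the Lie derivative of $g$ in the direction of $V$; (ii) $V$ is a concircular vector field with the constant function $a$, that is, $\nabla_X V=aX$ for every vector field $X$ on $M$. Then $(M,g)$ is Ricci-flat, that is, $\mathrm{Ric}=0$ on $M$. -/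

import Mathlib

open Bundle VectorField FiberBundle NormedSpace
open scoped Manifold ContDiff

noncomputable section

section RiemannianGeometry

variable {E : Type*} [NormedAddCommGroup E] [NormedSpace ℝ E]
  {H : Type*} [TopologicalSpace H] (I : ModelWithCorners ℝ E H)
  {M : Type*} [TopologicalSpace M] [ChartedSpace H M]
  [RiemannianBundle (fun x : M ↦ TangentSpace I x)]

/-- The function `g(X, Y)` of two vector fields, where `g` is the Riemannian metric. -/
def metricFun (X Y : Π x : M, TangentSpace I x) (x : M) : ℝ :=
  inner ℝ (X x) (Y x)

/-- The right-hand side of the Koszul formula, so that `g(∇_X Y, Z) = koszul X Y Z`. -/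
def koszul (X Y Z : Π x : M, TangentSpace I x) (x : M) : ℝ :=
  (1 / 2 : ℝ) *
    (mvfderiv I (metricFun I Y Z) x (X x)
      + mvfderiv I (metricFun I Z X) x (Y x)
      - mvfderiv I (metricFun I X Y) x (Z x)
      + inner ℝ (mlieBracket I X Y x) (Z x)
      - inner ℝ (mlieBracket I X Z x) (Y x)
      - inner ℝ (mlieBracket I Y Z x) (X x))

/-- The Lie derivative of the metric:
`(𝓛_V g)(X, Y) = V (g(X, Y)) - g([V, X], Y) - g(X, [V, Y])`. -/
def lieDerivMetric (V X Y : Π x : M, TangentSpace I x) (x : M) : ℝ :=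
  mvfderiv I (metricFun I X Y) x (V x)
    - inner ℝ (mlieBracket I V X x) (Y x) - inner ℝ (X x) (mlieBracket I V Y x)

theorem metricFun_comm (X Y : Π x : M, TangentSpace I x) : metricFun I X Y = metricFun I Y X := by
  funext x
  exact real_inner_comm _ _

section

variable [IsManifold I ∞ M]
  [IsContMDiffRiemannianBundle I ∞ E (fun x : M ↦ TangentSpace I x)]
  {X X' Y Y' Z Z' : Π x : M, TangentSpace I x} {f : M → ℝ} {x : M}

theorem mdiffAt_metricFun (hX : MDiffAt (T% X) x) (hY : MDiffAt (T% Y) x) :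
    MDiffAt (metricFun I X Y) x :=
  MDifferentiableAt.inner_bundle hX hY

theorem mvfderiv_metricFun_add_left (hX : MDiffAt (T% X) x) (hX' : MDiffAt (T% X') x)
    (hY : MDiffAt (T% Y) x) :
    mvfderiv I (metricFun I (X + X') Y) x
      = mvfderiv I (metricFun I X Y) x + mvfderiv I (metricFun I X' Y) x := by
  have h : metricFun I (X + X') Y = metricFun I X Y + metricFun I X' Y := by
    funext y
    exact inner_add_left _ _ _
  rw [h, mvfderiv_add (mdiffAt_metricFun I hX hY) (mdiffAt_metricFun I hX' hY)]

theorem mvfderiv_metricFun_smul_left (hf : MDiffAt f x) (hX : MDiffAt (T% X) x)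
    (hY : MDiffAt (T% Y) x) :
    mvfderiv I (metricFun I (f • X) Y) x
      = f x • mvfderiv I (metricFun I X Y) x + metricFun I X Y x • mvfderiv I f x := by
  have h : metricFun I (f • X) Y = f * metricFun I X Y := by
    funext y
    exact real_inner_smul_left _ _ _
  rw [h, mvfderiv_mul hf (mdiffAt_metricFun I hX hY)]

theorem mvfderiv_metricFun_add_right (hX : MDiffAt (T% X) x) (hX' : MDiffAt (T% X') x)
    (hY : MDiffAt (T% Y) x) :
    mvfderiv I (metricFun I Y (X + X')) x
      = mvfderiv I (metricFun I Y X) x + mvfderiv I (metricFun I Y X') x := by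
  simp only [metricFun_comm I Y]
  exact mvfderiv_metricFun_add_left I hX hX' hY

theorem mvfderiv_metricFun_smul_right (hf : MDiffAt f x) (hX : MDiffAt (T% X) x)
    (hY : MDiffAt (T% Y) x) :
    mvfderiv I (metricFun I Y (f • X)) x
      = f x • mvfderiv I (metricFun I Y X) x + metricFun I Y X x • mvfderiv I f x := by
  simp only [metricFun_comm I Y]
  exact mvfderiv_metricFun_smul_left I hf hX hY

variable [FiniteDimensional ℝ E]

theorem koszul_tensorial_left (hY : MDiffAt (T% Y) x) (hZ : MDiffAt (T% Z) x) :
    TensorialAt I E (fun X ↦ koszul I X Y Z x) x where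
  smul hf hX := by
    simp only [koszul, mvfderiv_metricFun_smul_left I hf hX hY,
      mvfderiv_metricFun_smul_right I hf hX hZ, mlieBracket_smul_left hf hX, Pi.smul_apply',
      metricFun, inner_add_left, inner_smul_left, inner_smul_right,
      _root_.add_apply, _root_.smul_apply, map_smul, smul_eq_mul,
      RCLike.conj_to_real, inner_neg_left, neg_smul]
    rw [real_inner_comm (Z x)]
    ring
  add hX hX' := by
    simp only [koszul, mvfderiv_metricFun_add_left I hX hX' hY,
      mvfderiv_metricFun_add_right I hX hX' hZ, mlieBracket_add_left hX hX', Pi.add_apply,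
      inner_add_left, inner_add_right, _root_.add_apply, map_add]
    ring

theorem koszul_tensorial_right (hX : MDiffAt (T% X) x) (hY : MDiffAt (T% Y) x) :
    TensorialAt I E (fun Z ↦ koszul I X Y Z x) x where
  smul := by
    intro f Z hf hZ
    simp only [koszul, mvfderiv_metricFun_smul_left I hf hZ hX,
      mvfderiv_metricFun_smul_right I hf hZ hY, mlieBracket_smul_right hf hZ, Pi.smul_apply',
      metricFun, inner_add_left, inner_smul_left, inner_smul_right,
      _root_.add_apply, _root_.smul_apply, map_smul, smul_eq_mul,
      RCLike.conj_to_real]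
    rw [real_inner_comm (Y x) (Z x), real_inner_comm (X x) (Z x)]
    ring
  add hZ hZ' := by
    simp only [koszul, mvfderiv_metricFun_add_left I hZ hZ' hX,
      mvfderiv_metricFun_add_right I hZ hZ' hY, mlieBracket_add_right hZ hZ', Pi.add_apply,
      inner_add_left, inner_add_right, _root_.add_apply, map_add]
    ring

theorem koszul_add_mid (hX : MDiffAt (T% X) x) (hY : MDiffAt (T% Y) x)
    (hY' : MDiffAt (T% Y') x) (hZ : MDiffAt (T% Z) x) :
    koszul I X (Y + Y') Z x = koszul I X Y Z x + koszul I X Y' Z x := by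
  simp only [koszul, mvfderiv_metricFun_add_left I hY hY' hZ,
    mvfderiv_metricFun_add_right I hY hY' hX, mlieBracket_add_right hY hY',
    mlieBracket_add_left hY hY', Pi.add_apply,
    inner_add_left, inner_add_right, _root_.add_apply, map_add]
  ring

theorem koszul_smul_mid (hf : MDiffAt f x) (hX : MDiffAt (T% X) x) (hY : MDiffAt (T% Y) x)
    (hZ : MDiffAt (T% Z) x) :
    koszul I X (f • Y) Z x
      = f x * koszul I X Y Z x + mvfderiv I f x (X x) * inner ℝ (Y x) (Z x) := by
  simp only [koszul, mvfderiv_metricFun_smul_left I hf hY hZ,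
    mvfderiv_metricFun_smul_right I hf hY hX, mlieBracket_smul_left hf hY,
    mlieBracket_smul_right hf hY, Pi.smul_apply',
    metricFun, inner_add_left, inner_smul_left, inner_smul_right,
    _root_.add_apply, _root_.smul_apply, map_smul, smul_eq_mul,
    RCLike.conj_to_real, inner_neg_left, neg_smul]
  rw [real_inner_comm (X x) (Y x)]
  ring

/-- The bilinear form `(u, w) ↦ g(∇_u Y, w)` on the tangent space at `x` that the Koszul formula
defines. -/
def koszulForm (hY : MDiffAt (T% Y) x) :
    TangentSpace I x →L[ℝ] TangentSpace I x →L[ℝ] ℝ :=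
  TensorialAt.mkHom₂ (I := I) (F := E) (F' := E) (fun X Z ↦ koszul I X Y Z x) x
    (fun _ hZ ↦ koszul_tensorial_left I hY hZ) (fun _ hX ↦ koszul_tensorial_right I hX hY)

theorem koszulForm_apply (hX : MDiffAt (T% X) x) (hY : MDiffAt (T% Y) x)
    (hZ : MDiffAt (T% Z) x) :
    koszulForm I hY (X x) (Z x) = koszul I X Y Z x :=
  TensorialAt.mkHom₂_apply (I := I) (F := E) (F' := E) (Φ := fun X Z ↦ koszul I X Y Z x)
    (fun _ hZ ↦ koszul_tensorial_left I hY hZ) (fun _ hX ↦ koszul_tensorial_right I hX hY) hX hZ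

open Classical in
/-- The vector `∇_u Y` is the one that represents `w ↦ g(∇_u Y, w)`. -/
def leviCivitaFun (Y : Π x : M, TangentSpace I x) (x : M) :
    TangentSpace I x →L[ℝ] TangentSpace I x :=
  haveI : FiniteDimensional ℝ (TangentSpace I x) := inferInstanceAs (FiniteDimensional ℝ E)
  haveI : CompleteSpace (TangentSpace I x) := FiniteDimensional.complete ℝ _
  if hY : MDiffAt (T% Y) x then
    InnerProductSpace.continuousLinearMapOfBilin (𝕜 := ℝ) (koszulForm I hY)
  else 0

theorem inner_leviCivitaFun (hX : MDiffAt (T% X) x) (hY : MDiffAt (T% Y) x)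
    (hZ : MDiffAt (T% Z) x) :
    inner ℝ (leviCivitaFun I Y x (X x)) (Z x) = koszul I X Y Z x := by
  have : FiniteDimensional ℝ (TangentSpace I x) := inferInstanceAs (FiniteDimensional ℝ E)
  have : CompleteSpace (TangentSpace I x) := FiniteDimensional.complete ℝ _
  rw [← koszulForm_apply I hX hY hZ, leviCivitaFun, dif_pos hY]
  exact InnerProductSpace.continuousLinearMapOfBilin_apply _ _ _

theorem leviCivitaFun_eq {A : TangentSpace I x →L[ℝ] TangentSpace I x} (hY : MDiffAt (T% Y) x)
    (h : ∀ X Z : Π x : M, TangentSpace I x, MDiffAt (T% X) x → MDiffAt (T% Z) x →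
      koszul I X Y Z x = inner ℝ (A (X x)) (Z x)) :
    leviCivitaFun I Y x = A := by
  ext u
  refine ext_inner_right ℝ fun w ↦ ?_
  have hu := mdifferentiableAt_extend I E u
  have hw := mdifferentiableAt_extend I E w
  have h1 := inner_leviCivitaFun I hu hY hw
  rw [h _ _ hu hw] at h1
  simpa using h1

variable (M) in
/-- The Levi-Civita connection of the metric: `leviCivita I M Y x u` is `∇_u Y` for `u` tangent
at `x`. -/
def leviCivita : CovariantDerivative I E (TangentSpace I : M → Type _) where
  toFun := leviCivitaFun I
  isCovariantDerivativeOnUniv :=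
    { add := by
        intro Y Y' x hY hY' _
        refine leviCivitaFun_eq I (mdifferentiableAt_add_section hY hY') fun X Z hX hZ ↦ ?_
        rw [koszul_add_mid I hX hY hY' hZ, _root_.add_apply, inner_add_left,
          inner_leviCivitaFun I hX hY hZ, inner_leviCivitaFun I hX hY' hZ]
      leibniz := by
        intro Y f x hY hf _
        refine leviCivitaFun_eq I (hf.smul_section hY) fun X Z hX hZ ↦ ?_
        rw [koszul_smul_mid I hf hX hY hZ, _root_.add_apply, inner_add_left, _root_.smul_apply,
          ContinuousLinearMap.smulRight_apply, real_inner_smul_left, real_inner_smul_left,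
          inner_leviCivitaFun I hX hY hZ] }

theorem inner_leviCivita (hX : MDiffAt (T% X) x) (hY : MDiffAt (T% Y) x)
    (hZ : MDiffAt (T% Z) x) :
    inner ℝ (leviCivita I M Y x (X x)) (Z x) = koszul I X Y Z x :=
  inner_leviCivitaFun I hX hY hZ

/-- The Levi-Civita connection is torsion-free. -/
theorem leviCivita_torsion : (leviCivita I M).torsion = 0 := by
  rw [CovariantDerivative.torsion_eq_zero_iff]
  intro X Y x hX hY
  refine ext_inner_right ℝ fun w ↦ ?_
  have hw := mdifferentiableAt_extend I E w
  have h1 := inner_leviCivita I hX hY hw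
  have h2 := inner_leviCivita I hY hX hw
  rw [extend_apply_self] at h1 h2
  rw [inner_sub_left, h1, h2]
  simp only [koszul, metricFun_comm I Y X, metricFun_comm I (extend E w),
    mlieBracket_swap_apply (V := Y) (W := X), inner_neg_left, extend_apply_self]
  ring

/-- The Levi-Civita connection is compatible with the metric. -/
theorem leviCivita_metric (hX : MDiffAt (T% X) x) (hY : MDiffAt (T% Y) x)
    (hZ : MDiffAt (T% Z) x) :
    mvfderiv I (metricFun I Y Z) x (X x) = inner ℝ (leviCivita I M Y x (X x)) (Z x)
      + inner ℝ (Y x) (leviCivita I M Z x (X x)) := by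
  rw [real_inner_comm (leviCivita I M Z x (X x)), inner_leviCivita I hX hY hZ,
    inner_leviCivita I hX hZ hY]
  simp only [koszul, metricFun_comm I Z X, metricFun_comm I Y X, metricFun_comm I Z Y,
    mlieBracket_swap_apply (V := Z) (W := Y), inner_neg_left]
  ring

/-- The curvature `R(X, Y) Z = ∇_X ∇_Y Z - ∇_Y ∇_X Z - ∇_[X, Y] Z`. -/
def curvature (X Y Z : Π x : M, TangentSpace I x) (x : M) : TangentSpace I x :=
  leviCivita I M (fun y ↦ leviCivita I M Z y (Y y)) x (X x)
    - leviCivita I M (fun y ↦ leviCivita I M Z y (X y)) x (Y x)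
    - leviCivita I M Z x (mlieBracket I X Y x)

/-- The Ricci curvature `Ric(Y, Z)`, the trace of `X ↦ R(X, Y) Z`: at the point `x` it is
`∑ i, g(R(E i, Y) Z, e i)`, where `e` is an orthonormal basis of the tangent space at `x` and
`E i` is a vector field, smooth near `x`, with the value `e i` at `x`. -/
def ricci (Y Z : Π x : M, TangentSpace I x) (x : M) : ℝ :=
  haveI : FiniteDimensional ℝ (TangentSpace I x) := inferInstanceAs (FiniteDimensional ℝ E)
  let e := stdOrthonormalBasis ℝ (TangentSpace I x)
  ∑ i, inner ℝ (curvature I (extend E (e i)) Y Z x) (e i)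

variable (M) in
/-- The Riemannian manifold is Ricci-flat: its Ricci tensor field vanishes. -/
def IsRicciFlat : Prop :=
  ∀ X Y : Π x : M, TangentSpace I x, CMDiff ∞ (T% X) → CMDiff ∞ (T% Y) →
    ∀ x : M, ricci I X Y x = 0

/-- `V` is a concircular vector field with the function `a`: both are smooth, and
`∇_X V = a X` for all `X`. -/
structure IsConcircular (V : Π x : M, TangentSpace I x) (a : M → ℝ) : Prop where
  smooth_field : CMDiff ∞ (T% V)
  smooth_fun : CMDiff ∞ a
  eq : ∀ (x : M) (u : TangentSpace I x), leviCivita I M V x u = a x • u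

/-- `(V, lam)` is an almost Ricci soliton: `V` is a smooth vector field, `lam` is a smooth
function, and `(1/2) 𝓛_V g + Ric = lam g`. -/
structure IsAlmostRicciSoliton (V : Π x : M, TangentSpace I x) (lam : M → ℝ) : Prop where
  smooth_field : CMDiff ∞ (T% V)
  smooth_fun : CMDiff ∞ lam
  eq : ∀ X Y : Π x : M, TangentSpace I x, CMDiff ∞ (T% X) → CMDiff ∞ (T% Y) →
    ∀ x : M, (1 / 2 : ℝ) * lieDerivMetric I V X Y x + ricci I X Y x = lam x * metricFun I X Y x

end

end RiemannianGeometry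

end

section ConcircularFields

variable {E : Type*} [NormedAddCommGroup E] [NormedSpace ℝ E]
  {H : Type*} [TopologicalSpace H] (I : ModelWithCorners ℝ E H)
  {M : Type*} [TopologicalSpace M] [ChartedSpace H M]
  [RiemannianBundle (fun x : M ↦ TangentSpace I x)]
  [IsManifold I ∞ M] [IsContMDiffRiemannianBundle I ∞ E (fun x : M ↦ TangentSpace I x)]
  [FiniteDimensional ℝ E]
  {X Y V : Π x : M, TangentSpace I x} {x : M}

/-! Since `∇V = a · Id`, the flow of `V` scales the metric: `𝓛_V g = 2a g`. The soliton equation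
becomes `Ric = (λ - a) g`, so it remains to show `λ = a`. Because `a` is constant and the connection
is torsion-free, `R(X, Y)V = 0`, hence `Ric(·, V) = 0`. Evaluating the soliton equation on `(V, V)`
gives `(λ - a)|V|² = 0`, so `λ = a` wherever `V ≠ 0`. The zeros of `V` contain no open set, as `∇V`
would vanish there, and continuity of `λ` gives `λ = a` everywhere. -/

/-- The bracket in terms of the Levi-Civita connection. -/
theorem mlieBracket_eq_leviCivita (hX : MDiffAt (T% X) x) (hY : MDiffAt (T% Y) x) :
    mlieBracket I X Y x = leviCivita I M Y x (X x) - leviCivita I M X x (Y x) :=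
  ((leviCivita I M).torsion_eq_zero_iff.mp (leviCivita_torsion I) hX hY).symm

theorem leviCivita_const_smul (a : ℝ) (hY : MDiffAt (T% Y) x) :
    leviCivita I M (fun y ↦ a • Y y) x = a • leviCivita I M Y x :=
  (leviCivita I M).isCovariantDerivativeOnUniv.smul_const a hY

/-- A field that satisfies `∇_X V = a X` at `x`, with `a ≠ 0`, does not vanish identically near `x`. -/
theorem not_eventually_eq_zero_of_leviCivita_eq [Nontrivial E] {a : ℝ} (ha : a ≠ 0)
    (hV : MDiffAt (T% V) x) (h : ∀ u : TangentSpace I x, leviCivita I M V x u = a • u) :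
    ¬ ∀ᶠ y in nhds x, V y = 0 := by
  intro h0
  have : Nontrivial (TangentSpace I x) := inferInstanceAs (Nontrivial E)
  obtain ⟨u, hu⟩ := exists_ne (0 : TangentSpace I x)
  -- A covariant derivative at `x` depends only on the germ of the section, so `∇V` agrees at `x`
  -- with the derivative of the zero section.
  have h1 := (leviCivita I M).isCovariantDerivativeOnUniv.congr_of_eventuallyEq hV
    (mdifferentiableAt_zeroSection ..) Filter.univ_mem (σ' := 0) h0
  have h2 := h u
  rw [h1, (leviCivita I M).isCovariantDerivativeOnUniv.zero] at h2
  exact smul_ne_zero ha hu h2.symm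

variable {I} {a : ℝ}

/-- A concircular field with a constant function is homothetic. -/
theorem IsConcircular.lieDerivMetric_eq (hV : IsConcircular I V fun _ ↦ a)
    (hX : MDiffAt (T% X) x) (hY : MDiffAt (T% Y) x) :
    lieDerivMetric I V X Y x = 2 * a * metricFun I X Y x := by
  have hV' : MDiffAt (T% V) x := (hV.smooth_field x).mdifferentiableAt (by simp)
  -- The terms in `∇_V X` and `∇_V Y` from metric compatibility cancel those from the brackets; `∇_X
  -- V` and `∇_Y V` each leave `a g(X, Y)`.
  rw [lieDerivMetric, leviCivita_metric I hV' hX hY, mlieBracket_eq_leviCivita I hV' hX,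
    mlieBracket_eq_leviCivita I hV' hY, hV.eq, hV.eq, inner_sub_left, inner_sub_right,
    real_inner_smul_left, real_inner_smul_right, metricFun]
  ring

/-- As `∇_X V = aX` holds at every point, it can be differentiated again: `R(X, Y)V = a(∇_X Y - ∇_Y
X - [X, Y])`, which is `a` times the torsion. -/
theorem IsConcircular.curvature_eq_zero (hV : IsConcircular I V fun _ ↦ a)
    (hX : MDiffAt (T% X) x) (hY : MDiffAt (T% Y) x) : curvature I X Y V x = 0 := by
  simp only [curvature, hV.eq]
  rw [leviCivita_const_smul I a hX, leviCivita_const_smul I a hY,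
    mlieBracket_eq_leviCivita I hX hY]
  simp only [_root_.smul_apply, smul_sub, sub_self]

theorem IsConcircular.ricci_eq_zero (hV : IsConcircular I V fun _ ↦ a) (hY : MDiffAt (T% Y) x) :
    ricci I Y V x = 0 :=
  Finset.sum_eq_zero fun _ _ ↦ by
    rw [hV.curvature_eq_zero (mdifferentiableAt_extend I E _) hY, inner_zero_left]

/-- The function of an almost Ricci soliton whose field is concircular with the nonzero constant
`a` is equal to `a`. -/
theorem IsAlmostRicciSoliton.eq_of_isConcircular [Nontrivial E] {lam : M → ℝ}
    (hsol : IsAlmostRicciSoliton I V lam) (hV : IsConcircular I V fun _ ↦ a) (ha : a ≠ 0) (x : M) :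
    lam x = a := by
  have hd (y : M) : MDiffAt (T% V) y := (hV.smooth_field y).mdifferentiableAt (by simp)
  have key (y : M) (hy : V y ≠ 0) : lam y = a := by
    have h := hsol.eq V V hV.smooth_field hV.smooth_field y
    -- The equation on `(V, V)` reduces to `a|V|² = λ|V|²`.
    rw [hV.lieDerivMetric_eq (hd y) (hd y), hV.ricci_eq_zero (hd y)] at h
    have h0 : metricFun I V V y ≠ 0 := inner_self_ne_zero.mpr hy
    apply mul_right_cancel₀ h0
    linarith
  by_contra hne
  refine not_eventually_eq_zero_of_leviCivita_eq I ha (hd x) (hV.eq x) ?_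
  -- The condition `λ ≠ a` is open, and wherever it holds `key` forces `V = 0`.
  filter_upwards [hsol.smooth_fun.continuous.continuousAt.eventually_ne hne] with y hy
  exact not_imp_comm.mp (key y) hy

end ConcircularFields

theorem mainTheorem5 (n : ℕ) (hn : 3 < n)
    {M : Type*} [TopologicalSpace M] [T2Space M]
    [ChartedSpace (EuclideanSpace ℝ (Fin n)) M] [IsManifold (𝓡 n) ∞ M]
    [RiemannianBundle (fun x : M ↦ TangentSpace (𝓡 n) x)]
    [IsContMDiffRiemannianBundle (𝓡 n) ∞ (EuclideanSpace ℝ (Fin n))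
      (fun x : M ↦ TangentSpace (𝓡 n) x)]
    (V : Π x : M, TangentSpace (𝓡 n) x) (lam : M → ℝ) (a : ℝ) (ha : a ≠ 0)
    (hsol : IsAlmostRicciSoliton (𝓡 n) V lam)
    (hV : IsConcircular (𝓡 n) V (fun _ ↦ a)) :
    IsRicciFlat (𝓡 n) M := by
  -- Positive dimension provides the nonzero tangent vector on which `a · Id` does not vanish.
  have : Nonempty (Fin n) := ⟨⟨0, by omega⟩⟩
  have : Nontrivial (EuclideanSpace ℝ (Fin n)) := inferInstance
  intro X Y hX hY x
  have h := hsol.eq X Y hX hY x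
  rw [hV.lieDerivMetric_eq ((hX x).mdifferentiableAt (by simp))
    ((hY x).mdifferentiableAt (by simp)), hsol.eq_of_isConcircular hV ha] at h
  linarith
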